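/- Let $X$ be a real random variable with distribution function $F(t)=\mathbb P(X\le t)$ and let $\alpha\in(0,\tfrac12)$. For a distribution function $G$ put $\mathrm{VaR}_u(G)=\inf\{t\in\mathbb R: G(t)\ge u\}$ and $\mathrm{ES}_\alpha(G)=\frac1\alpha\int_{1-\alpha}^1\mathrm{VaR}_u(G)\,du$, write $\mathrm{VaR}_u(X)=\mathrm{VaR}_u(F)$, $\mathrm{ES}_\alpha(X)=\mathrm{ES}_\alpha(F)$, and let $$\sigma_{\mathrm{ES}}^2=\frac1{\alpha^2}\int_{\mathrm{VaR}_{1-\alpha}(X)}^\infty\int_{\mathrm{VaR}_{1-\alpha}(X)}^\infty \bigl(F(\min\{t,s\})-F(t)F(s)\bigr)\,dt\,ds\in[0,\infty].$$ For $\varepsilon>0$, $0.35\le\beta_1\le\beta_2\le0.65$ and $x\in\mathbb R^N$ define the estimator $\widehat S_N(x)$ as follows. Let $m=\lceil 11/\varepsilon^2\rceil$, $n=\lfloor N/m\rfloor$, $I_j=\{(j-1)m+1,\dots,jm\}$ for $1\le j\le n$. For $I\subseteq\{1,\dots,N\}$ nonempty let $\widehat T_I=\mathrm{ES}_\alpha(\widehat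 F_I)$ with $\widehat F_I(t)=\frac1{|I|}|\{i\in I: x_i\le t\}|$, and let $\widehat T_N=\widehat T_{\{1,\dots,N\}}$. Let $\widehat T_{(1)}\le\dots\le\widehat T_{(n)}$ be the order statistics of $(\widehat T_{I_j})_{j=1}^n$, and let $\hat Q$ be the function on $[0,1]$ with $\hat Q(\frac{j-1}{n-1})=\widehat T_{(j)}$ for $j=1,\dots,n$ and affine in between. Then $\widehat S_N=\min\{\max\{\widehat T_N,\hat Q(\beta_1)\},\hat Q(\beta_2)\}$. **Theorem.** There are absolute constants $c_0,c_1,C_0,C_1,C_2>0$ such that the following holds for all $X$, $\alpha\in(0,\frac12)$, $L\ge0$ and $0.35\le\beta_1\le\beta_2\le0.65$. Assume that $\sigma^2_{\mathrm{ES}}<\infty$, that $u\mapsto\mathrm{VaR}_u(X)$ is $L$-Lipschitz on $[1-2\alpha,1-\frac12\alpha]$, and that $\sigma_{\mathrm{ES}}$ and $L$ are not both zero. Let $0<\varepsilon<c_0\sqrt\alpha$ and $N\ge c_1\varepsilon^{-2}$, let $X_1,\dots,X_N$ be i.i.d. copies of $X$, and let $Y_1,\dots,Y_N$ be the data after an adversary,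 who knows the whole sample and the estimation procedure, has arbitrarily modified at most $C_0N\varepsilon^2$ of them; that is, $(Y_i)_{i\le N}$ are arbitrary functions on the underlying probability space with $|\{i: Y_i\ne X_i\}|\le C_0N\varepsilon^2$ almost surely. Then $$\mathbb P\Bigl(\bigl|\widehat S_N(Y_1,\dots,Y_N)-\mathrm{ES}_\alpha(X)\bigr|\ge\varepsilon\sigma_{\mathrm{ES}}+C_1L\varepsilon^2\Bigr)\le\exp(-C_2N\varepsilon^2),$$ where $\mathbb P$ is read as the outer probability if the event is not measurable. -/

import Mathlib

open MeasureTheory ProbabilityTheory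

noncomputable section

namespace ExpectedShortfall

/-- The distribution function `t ↦ ℙ(X ≤ t)` of a real random variable `X`. -/
def distFun {Ω : Type*} [MeasurableSpace Ω] (μ : Measure Ω) (X : Ω → ℝ) (t : ℝ) : ℝ :=
  μ.real {ω | X ω ≤ t}

/-- Value at risk at level `u` of a distribution function: `inf {t : F t ≥ u}`. -/
def VaR (F : ℝ → ℝ) (u : ℝ) : ℝ := sInf {t : ℝ | u ≤ F t}

/-- Expected shortfall at level `α` of a distribution function. -/
def ES (α : ℝ) (F : ℝ → ℝ) : ℝ := (1 / α) * ∫ u in (1 - α)..1, VaR F u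

/-- The variance `σ²` associated with the estimation of the expected shortfall,
with values in `[0, ∞]`. -/
def sigmaSq (α : ℝ) (F : ℝ → ℝ) : ENNReal :=
  ENNReal.ofReal (1 / α ^ 2) *
    ∫⁻ t in Set.Ioi (VaR F (1 - α)), ∫⁻ s in Set.Ioi (VaR F (1 - α)),
      ENNReal.ofReal (F (min t s) - F t * F s)

/-- The standard deviation `σ` (meaningful when `sigmaSq α F` is finite). -/
def sigma (α : ℝ) (F : ℝ → ℝ) : ℝ := Real.sqrt (sigmaSq α F).toReal

/-- The empirical distribution function of the sub-sample `(x i)_{i ∈ I}`. -/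
def empDistFun {N : ℕ} (x : Fin N → ℝ) (I : Finset (Fin N)) (t : ℝ) : ℝ :=
  ((I.filter fun i => x i ≤ t).card : ℝ) / (I.card : ℝ)

/-- The plug-in estimator of the expected shortfall from the sub-sample `(x i)_{i ∈ I}`. -/
def plugIn (α : ℝ) {N : ℕ} (x : Fin N → ℝ) (I : Finset (Fin N)) : ℝ :=
  ES α (empDistFun x I)

/-- The block length `m = ⌈11 / ε²⌉`. -/
def blockLength (ε : ℝ) : ℕ := ⌈11 / ε ^ 2⌉₊

/-- The number of blocks `n = ⌊N / m⌋`. -/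
def numBlocks (ε : ℝ) (N : ℕ) : ℕ := N / blockLength ε

/-- The blocks, with samples and blocks both numbered from `0`: the block number `j` is
`{j m, …, (j + 1) m - 1}`. -/
def block (ε : ℝ) (N : ℕ) (j : Fin (numBlocks ε N)) : Finset (Fin N) :=
  Finset.univ.filter fun i : Fin N =>
    j.val * blockLength ε ≤ i.val ∧ i.val < (j.val + 1) * blockLength ε

/-- Order statistics, numbered from `0`: `orderStat y 0 ≤ ⋯ ≤ orderStat y (n - 1)`
(and the value `0` beyond the last index). -/
def orderStat {n : ℕ} (y : Fin n → ℝ) (k : ℕ) : ℝ :=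
  if h : k < n then y (Tuple.sort y ⟨k, h⟩) else 0

/-- The linearly interpolated empirical quantile function on `[0, 1]`: it takes the value
`orderStat y k` at `k / (n - 1)` for `k = 0, …, n - 1` and is affine in between. -/
def empQuantile {n : ℕ} (y : Fin n → ℝ) (β : ℝ) : ℝ :=
  let h : ℝ := ((n : ℝ) - 1) * β
  let k : ℕ := ⌊h⌋₊
  orderStat y k + (h - k) * (orderStat y (k + 1) - orderStat y k)

/-- The estimator: the plug-in estimator of the full sample, truncated to the interval between
the empirical `β₁`- and `β₂`-quantiles of the plug-in estimators of the blocks. -/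
def estimator (α ε β₁ β₂ : ℝ) {N : ℕ} (x : Fin N → ℝ) : ℝ :=
  let T : Fin (numBlocks ε N) → ℝ := fun j => plugIn α x (block ε N j)
  min (max (plugIn α x Finset.univ) (empQuantile T β₁)) (empQuantile T β₂)

end ExpectedShortfall

end

/-! The expected shortfall is the minimum over `q` of `q + E(X - q)⁺ / α`, attained at `q =
VaR_{1-α}` (`ES_le`, `ES_eq`), and the excess `(X - q)⁺` has variance `α²σ²` (`variance_posPart`).
The same formula holds for empirical distributions. Inserting the true `q` bounds the plug-in
estimator above by an average of i.i.d. excesses. It can fall below that average only through the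
error of the empirical quantile `p`. With `|p - q| ≤ Lδ` and frequencies near `q` correct up to `δ`,
this loss is at most `Lδ²/α` (`abs_plugIn_sub_lt`), and `δ = 2ε√α` makes it `4Lε²`.

On one block, Chebyshev's inequality for the excess and for four frequencies gives this accuracy
with failure probability at most `5/22` (`exists_bad_event`). Failures on disjoint blocks are
independent, so by Hoeffding's inequality (`measureReal_card_ge_le`) fewer than 28% of the blocks
fail, outside an event of exponentially small probability. Each modified datum spoils at most one
block, hence at most 5% more. With at most 33% outliers, all empirical quantiles between 0.35 and
0.65 lie in the target interval, and truncation forces the estimator into it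
(`abs_estimator_sub_lt`). -/

noncomputable section

namespace ExpectedShortfall

open Set Filter Topology

/-! ### Quantile functions and the variational formula for the expected shortfall. -/

section Quantile

variable {Ω : Type*} [MeasurableSpace Ω] {μ : Measure Ω} [IsProbabilityMeasure μ] {X : Ω → ℝ}

lemma distFun_eq_cdf (hX : Measurable X) (t : ℝ) : distFun μ X t = cdf (μ.map X) t := by
  have := Measure.isProbabilityMeasure_map (μ := μ) hX.aemeasurable
  rw [cdf_eq_real, map_measureReal_apply hX measurableSet_Iic]
  rfl

lemma distFun_mono : Monotone (distFun μ X) := fun _ _ hst =>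
  measureReal_mono fun _ hω => le_trans hω hst

lemma distFun_le_one (t : ℝ) : distFun μ X t ≤ 1 := measureReal_le_one

/-- The quantile function is the lower adjoint of the distribution function. -/
lemma VaR_le_iff (hX : Measurable X) {u t : ℝ} (hu : u ∈ Ioo (0 : ℝ) 1) :
    VaR (distFun μ X) u ≤ t ↔ u ≤ distFun μ X t := by
  have hF : distFun μ X = cdf (μ.map X) := funext (distFun_eq_cdf hX)
  rw [hF, VaR]
  set G := cdf (μ.map X)
  have hne : {t : ℝ | u ≤ G t}.Nonempty :=
    ((tendsto_cdf_atTop (μ.map X)).eventually_const_le hu.2).exists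
  obtain ⟨b, hb⟩ := ((tendsto_cdf_atBot (μ.map X)).eventually_lt_const hu.1).exists
  have hbdd : BddBelow {t : ℝ | u ≤ G t} := ⟨b, fun s hs => by
    by_contra! h
    exact absurd (le_trans hs (G.mono h.le)) (not_le.2 hb)⟩
  refine ⟨fun h => le_trans ?_ (G.mono h), fun h => csInf_le hbdd h⟩
  -- Right-continuity makes the infimum attained: every point to its right satisfies the inequality.
  refine ge_of_tendsto ((G.right_continuous (sInf {t : ℝ | u ≤ G t})).mono Ioi_subset_Ici_self) ?_
  filter_upwards [self_mem_nhdsWithin] with s hs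
  obtain ⟨r, hr, hrs⟩ := exists_lt_of_csInf_lt hne hs
  exact le_trans hr (G.mono hrs.le)

lemma le_distFun_VaR (hX : Measurable X) {u : ℝ} (hu : u ∈ Ioo (0 : ℝ) 1) :
    u ≤ distFun μ X (VaR (distFun μ X) u) := (VaR_le_iff hX hu).1 le_rfl

lemma VaR_monotoneOn (hX : Measurable X) : MonotoneOn (VaR (distFun μ X)) (Ioo 0 1) :=
  fun _ hu _ hv huv => (VaR_le_iff hX hu).2 (huv.trans (le_distFun_VaR hX hv))

lemma aemeasurable_VaR (hX : Measurable X) :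
    AEMeasurable (VaR (distFun μ X)) (volume.restrict (Ioo 0 1)) :=
  aemeasurable_restrict_of_monotoneOn measurableSet_Ioo (VaR_monotoneOn hX)

/-- The quantile function transports the uniform distribution to the law of `X`. -/
lemma map_VaR (hX : Measurable X) :
    (volume.restrict (Ioo (0 : ℝ) 1)).map (VaR (distFun μ X)) = μ.map X := by
  have := Measure.isProbabilityMeasure_map (μ := μ) hX.aemeasurable
  refine Eq.symm (Measure.ext_of_Iic _ _ fun t => ?_)
  rw [Measure.map_apply hX measurableSet_Iic,
    Measure.map_apply_of_aemeasurable (aemeasurable_VaR hX) measurableSet_Iic,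
    Measure.restrict_apply' measurableSet_Ioo]
  have h1 : VaR (distFun μ X) ⁻¹' Iic t ∩ Ioo 0 1 = Ioo 0 1 ∩ Iic (distFun μ X t) := by
    ext u
    constructor
    · exact fun h => ⟨h.2, (VaR_le_iff hX h.2).1 h.1⟩
    · exact fun h => ⟨(VaR_le_iff hX h.1).2 h.2, h.1⟩
  have h2 : volume (Ioo (0 : ℝ) 1 ∩ Iic (distFun μ X t)) = ENNReal.ofReal (distFun μ X t) := by
    have hae : (Ioo (0 : ℝ) 1 ∩ Iic (distFun μ X t) : Set ℝ) =ᵐ[volume]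
        (Ioc (0 : ℝ) 1 ∩ Iic (distFun μ X t) : Set ℝ) := Ioo_ae_eq_Ioc.inter (ae_eq_refl _)
    rw [measure_congr hae, Ioc_inter_Iic,
      min_eq_right (distFun_le_one t), Real.volume_Ioc, sub_zero]
  rw [h1, h2, distFun, ofReal_measureReal]
  rfl

/-- Under the uniform law on `(0, 1)`, monotonicity places the event `VaR v < VaR u` inside `(0,
u)`. Unlike `distFun`, the strict event excludes a possible atom at the quantile. -/
lemma measureReal_lt_VaR_le (hX : Measurable X) {u : ℝ} (hu : u ∈ Ioo (0 : ℝ) 1) :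
    μ.real {ω | X ω < VaR (distFun μ X) u} ≤ u := by
  have h : μ {ω | X ω < VaR (distFun μ X) u} ≤ ENNReal.ofReal u := by
    have h1 : μ {ω | X ω < VaR (distFun μ X) u} = μ.map X (Iio (VaR (distFun μ X) u)) := by
      rw [Measure.map_apply hX measurableSet_Iio]; rfl
    rw [h1, ← map_VaR hX,
      Measure.map_apply_of_aemeasurable (aemeasurable_VaR hX) measurableSet_Iio,
      Measure.restrict_apply' measurableSet_Ioo]
    refine (measure_mono (t := Ioo 0 u) fun v hv => ⟨hv.2.1, ?_⟩).trans_eq (by simp)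
    by_contra! h
    exact absurd hv.1 (not_lt.2 (VaR_monotoneOn hX hu hv.2 h))
  exact ENNReal.toReal_le_of_le_ofReal hu.1.le h

lemma ES_eq_setIntegral {α : ℝ} (hα : 0 < α) (F : ℝ → ℝ) :
    ES α F = (1 / α) * ∫ u in Ioo (1 - α) 1, VaR F u := by
  rw [ES, intervalIntegral.integral_of_le (by linarith), integral_Ioc_eq_integral_Ioo]

lemma integrableOn_posPart_VaR (hX : Measurable X) {q : ℝ}
    (hint : Integrable (fun ω => max (X ω - q) 0) μ) :
    IntegrableOn (fun u => max (VaR (distFun μ X) u - q) 0) (Ioo 0 1) := by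
  have hm : Measurable fun x : ℝ => max (x - q) 0 := by fun_prop
  have h1 : Integrable (fun x : ℝ => max (x - q) 0) (μ.map X) :=
    (integrable_map_measure hm.aestronglyMeasurable hX.aemeasurable).2 hint
  rw [← map_VaR hX] at h1
  exact (integrable_map_measure hm.aestronglyMeasurable (aemeasurable_VaR hX)).1 h1

lemma setIntegral_posPart_VaR (hX : Measurable X) (q : ℝ) :
    ∫ u in Ioo 0 1, max (VaR (distFun μ X) u - q) 0 = ∫ ω, max (X ω - q) 0 ∂μ := by
  have hm : Measurable fun x : ℝ => max (x - q) 0 := by fun_prop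
  rw [← integral_map (f := fun x : ℝ => max (x - q) 0) (aemeasurable_VaR hX)
    hm.aestronglyMeasurable, map_VaR hX,
    integral_map hX.aemeasurable hm.aestronglyMeasurable]

lemma Ioo_tail_subset {α : ℝ} (hα1 : α < 1) : Ioo (1 - α) 1 ⊆ Ioo (0 : ℝ) 1 :=
  Ioo_subset_Ioo_left (by linarith)

lemma integrableOn_VaR_tail (hX : Measurable X) {α : ℝ} (hα : 0 < α) (hα1 : α < 1)
    (hint : Integrable (fun ω => max (X ω - VaR (distFun μ X) (1 - α)) 0) μ) :
    IntegrableOn (VaR (distFun μ X)) (Ioo (1 - α) 1) := by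
  have h1 := ((integrableOn_posPart_VaR hX hint).mono_set (Ioo_tail_subset hα1)).add
    (integrableOn_const (C := VaR (distFun μ X) (1 - α)) (by simp))
  refine h1.congr_fun (fun u hu => ?_) measurableSet_Ioo
  have : VaR (distFun μ X) (1 - α) ≤ VaR (distFun μ X) u :=
    VaR_monotoneOn hX ⟨by linarith, by linarith⟩ (Ioo_tail_subset hα1 hu) hu.1.le
  simp only [Pi.add_apply]
  rw [max_eq_left (by linarith)]
  ring

/-- The tail interval has length `α`, so shifting the integrand by any constant `q` shifts the
average by `q`. -/
lemma ES_eq_add_setIntegral (hX : Measurable X) {α : ℝ} (hα : 0 < α) (hα1 : α < 1)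
    (hint : Integrable (fun ω => max (X ω - VaR (distFun μ X) (1 - α)) 0) μ) (q : ℝ) :
    ES α (distFun μ X) = q + (1 / α) * ∫ u in Ioo (1 - α) 1, (VaR (distFun μ X) u - q) := by
  rw [ES_eq_setIntegral hα, integral_sub (integrableOn_VaR_tail hX hα hα1 hint)
    (integrableOn_const (by simp))]
  simp only [integral_const, measureReal_restrict_apply_univ, Real.volume_real_Ioo, smul_eq_mul]
  rw [max_eq_left (by linarith)]
  field_simp
  ring

/-- The variational formula for the expected shortfall at its minimiser. -/
lemma ES_eq (hX : Measurable X) {α : ℝ} (hα : 0 < α) (hα1 : α < 1)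
    (hint : Integrable (fun ω => max (X ω - VaR (distFun μ X) (1 - α)) 0) μ) :
    ES α (distFun μ X) = VaR (distFun μ X) (1 - α)
      + (1 / α) * ∫ ω, max (X ω - VaR (distFun μ X) (1 - α)) 0 ∂μ := by
  have h1α : 1 - α ∈ Ioo (0 : ℝ) 1 := ⟨by linarith, by linarith⟩
  rw [ES_eq_add_setIntegral hX hα hα1 hint (VaR (distFun μ X) (1 - α)),
    ← setIntegral_posPart_VaR hX]
  congr 2
  -- For this `q` the positive part vanishes at levels up to `1 - α` and equals the plain difference
  -- above, so both steps that lose in `ES_le` are equalities.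
  rw [setIntegral_eq_of_subset_of_forall_sdiff_eq_zero measurableSet_Ioo (Ioo_tail_subset hα1)]
  · refine setIntegral_congr_fun measurableSet_Ioo fun u hu => ?_
    have := VaR_monotoneOn (μ := μ) hX h1α (Ioo_tail_subset hα1 hu) hu.1.le
    exact (max_eq_left (by linarith)).symm
  · rintro u ⟨hu, hu'⟩
    have hle : u ≤ 1 - α := by
      by_contra! h
      exact hu' ⟨h, hu.2⟩
    have := VaR_monotoneOn (μ := μ) hX hu h1α hle
    exact max_eq_right (by linarith)

/-- The variational upper bound for the expected shortfall. -/
lemma ES_le (hX : Measurable X) {α : ℝ} (hα : 0 < α) (hα1 : α < 1)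
    (hint : ∀ q, Integrable (fun ω => max (X ω - q) 0) μ) (q : ℝ) :
    ES α (distFun μ X) ≤ q + (1 / α) * ∫ ω, max (X ω - q) 0 ∂μ := by
  rw [ES_eq_add_setIntegral hX hα hα1 (hint _) q, ← setIntegral_posPart_VaR hX]
  have hq := integrableOn_posPart_VaR hX (hint q)
  refine add_le_add_right (mul_le_mul_of_nonneg_left ?_ (by positivity)) q
  calc ∫ u in Ioo (1 - α) 1, (VaR (distFun μ X) u - q)
      ≤ ∫ u in Ioo (1 - α) 1, max (VaR (distFun μ X) u - q) 0 :=
        setIntegral_mono ((integrableOn_VaR_tail hX hα hα1 (hint _)).sub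
          (integrableOn_const (by simp))) (hq.mono_set (Ioo_tail_subset hα1))
          fun u => le_max_left _ _
    _ ≤ _ := setIntegral_mono_set hq (Eventually.of_forall fun u => le_max_right _ _)
        (Ioo_tail_subset hα1).eventuallyLE

end Quantile

/-! ### Identification of `σ²` with the variance of the excess. -/

section Variance

lemma apply_min_sub_mul (F : ℝ → ℝ) (s t : ℝ) :
    F (min t s) - F t * F s = F (min t s) * (1 - F (max t s)) := by
  rcases le_total t s with h | h
  · rw [min_eq_left h, max_eq_right h]; ring
  · rw [min_eq_right h, max_eq_left h]; ring

variable {Ω : Type*} [MeasurableSpace Ω] {μ : Measure Ω} [IsProbabilityMeasure μ] {X : Ω → ℝ}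

lemma measure_gt_eq_ofReal (hX : Measurable X) (t : ℝ) :
    μ {ω | t < X ω} = ENNReal.ofReal (1 - distFun μ X t) := by
  have h : {ω | t < X ω} = {ω | X ω ≤ t}ᶜ := by ext; simp
  rw [distFun, ← probReal_compl_eq_one_sub (measurableSet_le hX measurable_const), ← h,
    ofReal_measureReal]

/-- Layer-cake representation; with Tonelli it turns moments of the excess into integrals of tail
probabilities. -/
lemma ofReal_posPart_eq_lintegral (x q : ℝ) :
    ENNReal.ofReal (max (x - q) 0) = ∫⁻ t in Ioi q, (Iio x).indicator 1 t := by
  rw [lintegral_indicator_one measurableSet_Iio, Measure.restrict_apply measurableSet_Iio,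
    inter_comm, Ioi_inter_Iio, Real.volume_Ioo, ENNReal.ofReal_max]
  simp

lemma measurable_indicator_Iio_uncurry (hX : Measurable X) :
    Measurable fun p : Ω × ℝ => (Iio (X p.1)).indicator (1 : ℝ → ENNReal) p.2 := by
  have : (fun p : Ω × ℝ => (Iio (X p.1)).indicator (1 : ℝ → ENNReal) p.2)
      = {p : Ω × ℝ | p.2 < X p.1}.indicator 1 := by
    ext p
    simp [indicator]
  rw [this]
  exact measurable_one.indicator (measurableSet_lt measurable_snd (hX.comp measurable_fst))

lemma lintegral_posPart_sub (hX : Measurable X) (q : ℝ) :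
    ∫⁻ ω, ENNReal.ofReal (max (X ω - q) 0) ∂μ = ∫⁻ t in Ioi q, μ {ω | t < X ω} := by
  simp_rw [ofReal_posPart_eq_lintegral]
  rw [lintegral_lintegral_swap (measurable_indicator_Iio_uncurry hX).aemeasurable]
  refine lintegral_congr fun t => ?_
  have : (fun ω => (Iio (X ω)).indicator (1 : ℝ → ENNReal) t) = {ω | t < X ω}.indicator 1 := by
    ext ω
    simp [indicator]
  rw [this, lintegral_indicator_one (measurableSet_lt measurable_const hX)]

lemma lintegral_posPart_sub_sq (hX : Measurable X) (q : ℝ) :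
    ∫⁻ ω, ENNReal.ofReal (max (X ω - q) 0) ^ 2 ∂μ
      = ∫⁻ t in Ioi q, ∫⁻ s in Ioi q, μ {ω | max t s < X ω} := by
  have hm := measurable_indicator_Iio_uncurry hX
  have hmω : ∀ ω, Measurable ((Iio (X ω)).indicator (1 : ℝ → ENNReal)) :=
    fun ω => measurable_one.indicator measurableSet_Iio
  have h1 : ∀ ω, ENNReal.ofReal (max (X ω - q) 0) ^ 2
      = ∫⁻ t in Ioi q, ∫⁻ s in Ioi q,
        (Iio (X ω)).indicator (1 : ℝ → ENNReal) t * (Iio (X ω)).indicator 1 s := by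
    intro ω
    rw [sq, ofReal_posPart_eq_lintegral, ← lintegral_mul_const _ (hmω ω)]
    exact lintegral_congr fun t => (lintegral_const_mul _ (hmω ω)).symm
  simp_rw [h1]
  rw [lintegral_lintegral_swap]
  · refine lintegral_congr fun t => ?_
    rw [lintegral_lintegral_swap]
    · refine lintegral_congr fun s => ?_
      have : (fun ω => (Iio (X ω)).indicator (1 : ℝ → ENNReal) t * (Iio (X ω)).indicator 1 s)
          = {ω | max t s < X ω}.indicator 1 := by
        ext ω
        by_cases h1 : t < X ω <;> by_cases h2 : s < X ω <;> simp [indicator, h1, h2]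
      rw [this, lintegral_indicator_one (measurableSet_lt measurable_const hX)]
    · exact ((hm.comp (by fun_prop : Measurable fun p : Ω × ℝ => (p.1, t))).mul hm).aemeasurable
  · refine Measurable.aemeasurable ?_
    have : Measurable fun p : (Ω × ℝ) × ℝ => (Iio (X p.1.1)).indicator (1 : ℝ → ENNReal) p.1.2
        * (Iio (X p.1.1)).indicator 1 p.2 :=
      (hm.comp measurable_fst).mul
        (hm.comp (by fun_prop : Measurable fun p : (Ω × ℝ) × ℝ => (p.1.1, p.2)))
    exact this.lintegral_prod_right'

lemma measurable_tail (hX : Measurable X) : Measurable fun t : ℝ => μ {ω | t < X ω} := by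
  simp_rw [measure_gt_eq_ofReal hX]
  exact ENNReal.measurable_ofReal.comp (measurable_const.sub distFun_mono.measurable)

/-- Hoeffding's covariance identity: with `G = 1 - F`, the integrand is `G (max t s) - G t * G s`.
The additive form avoids subtraction in `ENNReal` while finiteness is still unknown. -/
lemma lintegral_covariance_add (hX : Measurable X) (q : ℝ) :
    (∫⁻ t in Ioi q, ∫⁻ s in Ioi q,
        ENNReal.ofReal (distFun μ X (min t s) - distFun μ X t * distFun μ X s))
      + (∫⁻ ω, ENNReal.ofReal (max (X ω - q) 0) ∂μ) ^ 2
      = ∫⁻ ω, ENNReal.ofReal (max (X ω - q) 0) ^ 2 ∂μ := by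
  have hG := measurable_tail (μ := μ) hX
  rw [lintegral_posPart_sub hX, lintegral_posPart_sub_sq hX, sq, ← lintegral_mul_const _ hG,
    ← lintegral_add_right _ (hG.mul_const _)]
  refine lintegral_congr fun t => ?_
  rw [← lintegral_const_mul _ hG, ← lintegral_add_right _ (hG.const_mul _)]
  refine lintegral_congr fun s => ?_
  have ht := distFun_le_one (μ := μ) (X := X) t
  have hs := distFun_le_one (μ := μ) (X := X) s
  rw [measure_gt_eq_ofReal hX, measure_gt_eq_ofReal hX, measure_gt_eq_ofReal hX,
    ← ENNReal.ofReal_mul (by linarith), ← ENNReal.ofReal_add]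
  · congr 1
    rcases le_total t s with h | h
    · rw [min_eq_left h, max_eq_right h]; ring
    · rw [min_eq_right h, max_eq_left h]; ring
  · rw [apply_min_sub_mul]
    exact mul_nonneg measureReal_nonneg (by linarith [distFun_le_one (μ := μ) (X := X) (max t s)])
  · exact mul_nonneg (by linarith) (by linarith)

/-- Beyond the quantile `F ≥ 1 - α ≥ 1/2`, so `G (max t s) ≤ 2 F (min t s) G (max t s)` with `G = 1
- F`. Hence finiteness of `σ²` yields a finite second moment of the excess. -/
lemma lintegral_posPart_sub_sq_le (hX : Measurable X) {α : ℝ} (hα : 0 < α) (hα2 : α < 1 / 2) :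
    ∫⁻ ω, ENNReal.ofReal (max (X ω - VaR (distFun μ X) (1 - α)) 0) ^ 2 ∂μ
      ≤ 2 * ∫⁻ t in Ioi (VaR (distFun μ X) (1 - α)), ∫⁻ s in Ioi (VaR (distFun μ X) (1 - α)),
        ENNReal.ofReal (distFun μ X (min t s) - distFun μ X t * distFun μ X s) := by
  rw [lintegral_posPart_sub_sq hX, ← lintegral_const_mul' _ _ (by simp)]
  refine setLIntegral_mono' measurableSet_Ioi fun t ht => ?_
  rw [← lintegral_const_mul' _ _ (by simp)]
  refine setLIntegral_mono' measurableSet_Ioi fun s hs => ?_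
  have h1 : 1 - α ≤ distFun μ X (min t s) :=
    (le_distFun_VaR hX ⟨by linarith, by linarith⟩).trans (distFun_mono (le_min ht.le hs.le))
  have h2 := distFun_le_one (μ := μ) (X := X) (max t s)
  rw [measure_gt_eq_ofReal hX, apply_min_sub_mul,
    show (2 : ENNReal) = ENNReal.ofReal 2 by simp, ← ENNReal.ofReal_mul (by norm_num)]
  exact ENNReal.ofReal_le_ofReal (by nlinarith)

lemma lintegral_covariance_ne_top {α : ℝ} (hα : 0 < α) {F : ℝ → ℝ} (h : sigmaSq α F ≠ ⊤) :
    ∫⁻ t in Ioi (VaR F (1 - α)), ∫⁻ s in Ioi (VaR F (1 - α)),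
      ENNReal.ofReal (F (min t s) - F t * F s) ≠ ⊤ := by
  intro htop
  refine h ?_
  rw [sigmaSq, htop, ENNReal.mul_top]
  simp only [ne_eq, ENNReal.ofReal_eq_zero, not_le]
  positivity

lemma memLp_posPart (hX : Measurable X) {α : ℝ} (hα : 0 < α) (hα2 : α < 1 / 2)
    (hσ : sigmaSq α (distFun μ X) ≠ ⊤) :
    MemLp (fun ω => max (X ω - VaR (distFun μ X) (1 - α)) 0) 2 μ := by
  have hm : Measurable fun ω => max (X ω - VaR (distFun μ X) (1 - α)) 0 := by fun_prop
  rw [memLp_two_iff_integrable_sq hm.aestronglyMeasurable]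
  refine ⟨(hm.pow_const 2).aestronglyMeasurable, ?_⟩
  rw [hasFiniteIntegral_iff_ofReal (Eventually.of_forall fun ω => sq_nonneg _)]
  simp_rw [ENNReal.ofReal_pow (le_max_right _ (0 : ℝ))]
  exact (lintegral_posPart_sub_sq_le hX hα hα2).trans_lt
    (ENNReal.mul_lt_top (by simp) (lintegral_covariance_ne_top hα hσ).lt_top)

lemma sigma_nonneg (α : ℝ) (F : ℝ → ℝ) : 0 ≤ sigma α F := Real.sqrt_nonneg _

/-- The variance of the excess over the value at risk. -/
lemma variance_posPart (hX : Measurable X) {α : ℝ} (hα : 0 < α) (hα2 : α < 1 / 2)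
    (hσ : sigmaSq α (distFun μ X) ≠ ⊤) :
    Var[fun ω => max (X ω - VaR (distFun μ X) (1 - α)) 0; μ]
      = α ^ 2 * sigma α (distFun μ X) ^ 2 := by
  have hL2 := memLp_posPart hX hα hα2 hσ
  have hm : Measurable fun ω => max (X ω - VaR (distFun μ X) (1 - α)) 0 := by fun_prop
  have hA := lintegral_covariance_ne_top hα hσ
  have hadd := lintegral_covariance_add (μ := μ) hX (VaR (distFun μ X) (1 - α))
  have hI : ∫⁻ ω, ENNReal.ofReal (max (X ω - VaR (distFun μ X) (1 - α)) 0) ∂μ ≠ ⊤ := by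
    have := (hL2.integrable one_le_two).2
    exact ((hasFiniteIntegral_iff_ofReal
      (Eventually.of_forall fun ω => le_max_right (X ω - _) 0)).1 this).ne
  rw [variance_eq_sub hL2, sigma, Real.sq_sqrt ENNReal.toReal_nonneg, sigmaSq, ENNReal.toReal_mul,
    ENNReal.toReal_ofReal (by positivity)]
  have e1 : μ[(fun ω => max (X ω - VaR (distFun μ X) (1 - α)) 0) ^ 2]
      = (∫⁻ ω, ENNReal.ofReal (max (X ω - VaR (distFun μ X) (1 - α)) 0) ^ 2 ∂μ).toReal := by
    refine (integral_eq_lintegral_of_nonneg_ae (Eventually.of_forall fun ω => by simp)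
      (hm.pow_const 2).aestronglyMeasurable).trans ?_
    simp_rw [← ENNReal.ofReal_pow (le_max_right _ (0 : ℝ))]
  have e2 : μ[fun ω => max (X ω - VaR (distFun μ X) (1 - α)) 0]
      = (∫⁻ ω, ENNReal.ofReal (max (X ω - VaR (distFun μ X) (1 - α)) 0) ∂μ).toReal :=
    integral_eq_lintegral_of_nonneg_ae (Eventually.of_forall fun ω => le_max_right _ _)
      hm.aestronglyMeasurable
  rw [e1, e2, ← hadd, ENNReal.toReal_add hA (by finiteness), ENNReal.toReal_pow]
  field_simp
  ring

end Variance

/-! ### Plug-in estimators and their deterministic error bound. -/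

section Empirical

/-- The average of `f` over the finite set `I`. -/
def mean {ι : Type*} (I : Finset ι) (f : ι → ℝ) : ℝ := (∑ i ∈ I, f i) / I.card

lemma mean_mono {ι : Type*} {I : Finset ι} {f g : ι → ℝ} (h : ∀ i ∈ I, f i ≤ g i) :
    mean I f ≤ mean I g :=
  div_le_div_of_nonneg_right (Finset.sum_le_sum h) (Nat.cast_nonneg _)

lemma mean_add_mul_one_sub {ι : Type*} {I : Finset ι} (hI : I.Nonempty) (f g : ι → ℝ) (c : ℝ) :
    mean I (fun i => f i + c * (1 - g i)) = mean I f + c * (1 - mean I g) := by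
  have : (I.card : ℝ) ≠ 0 := by exact_mod_cast hI.card_pos.ne'
  simp only [mean, Finset.sum_add_distrib, ← Finset.mul_sum, Finset.sum_sub_distrib,
    Finset.sum_const, nsmul_eq_mul, mul_one]
  field_simp

variable {N : ℕ} {I : Finset (Fin N)}

lemma empDistFun_eq_mean (x : Fin N → ℝ) (I : Finset (Fin N)) (t : ℝ) :
    empDistFun x I t = mean I fun i => (Iic t).indicator 1 (x i) := by
  rw [empDistFun, mean, Finset.card_filter]
  simp [indicator]

/-- The sample `x` is itself a random variable on the index set with the uniform law on `I`, so all
facts on quantiles apply to empirical distributions. -/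
lemma empDistFun_eq_distFun (hI : I.Nonempty) (x : Fin N → ℝ) :
    empDistFun x I = distFun (PMF.uniformOfFinset I hI).toMeasure x := by
  ext t
  rw [distFun, measureReal_def, PMF.toMeasure_uniformOfFinset_apply hI _ .of_discrete,
    empDistFun, ENNReal.toReal_div]
  simp

lemma integral_uniformOfFinset (hI : I.Nonempty) (f : Fin N → ℝ) :
    ∫ i, f i ∂(PMF.uniformOfFinset I hI).toMeasure = mean I f := by
  rw [PMF.integral_eq_sum, mean, Finset.sum_div, ← Finset.sum_subset I.subset_univ]
  · refine Finset.sum_congr rfl fun i hi => ?_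
    rw [PMF.uniformOfFinset_apply_of_mem hI hi]
    simp [div_eq_inv_mul]
  · intro i _ hi
    simp [PMF.uniformOfFinset_apply_of_notMem hI hi]

lemma VaR_empDistFun_le_iff (hI : I.Nonempty) (x : Fin N → ℝ) {u t : ℝ}
    (hu : u ∈ Ioo (0 : ℝ) 1) : VaR (empDistFun x I) u ≤ t ↔ u ≤ empDistFun x I t := by
  rw [empDistFun_eq_distFun hI]
  exact VaR_le_iff .of_discrete hu

lemma plugIn_le (hI : I.Nonempty) (x : Fin N → ℝ) {α : ℝ} (hα : 0 < α) (hα1 : α < 1) (q : ℝ) :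
    plugIn α x I ≤ q + (1 / α) * mean I fun i => max (x i - q) 0 := by
  rw [plugIn, empDistFun_eq_distFun hI, ← integral_uniformOfFinset hI]
  exact ES_le .of_discrete hα hα1 (fun _ => .of_finite) q

lemma plugIn_eq (hI : I.Nonempty) (x : Fin N → ℝ) {α : ℝ} (hα : 0 < α) (hα1 : α < 1) :
    plugIn α x I = VaR (empDistFun x I) (1 - α)
      + (1 / α) * mean I fun i => max (x i - VaR (empDistFun x I) (1 - α)) 0 := by
  rw [plugIn, empDistFun_eq_distFun hI, ← integral_uniformOfFinset hI]
  exact ES_eq .of_discrete hα hα1 .of_finite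

/-- A deterministic error bound for the plug-in estimator: if the empirical excess over `q` and
the empirical frequencies near `q` are close to their targets, then so is the estimator. -/
lemma abs_plugIn_sub_lt (hI : I.Nonempty) (x : Fin N → ℝ) {α δ K r q q₁ q₂ e : ℝ} (hα : 0 < α)
    (hα1 : α < 1) (hδ : 0 ≤ δ) (hK : 0 ≤ K) (hq₁ : q - q₁ ≤ K) (hq₂ : q₂ - q ≤ K)
    (he : |mean I (fun i => max (x i - q) 0) - e| < α * r)
    (h₁ : mean I (fun i => (Iio q₁).indicator 1 (x i)) < 1 - α)
    (h₂ : 1 - α ≤ mean I fun i => (Iic q₂).indicator 1 (x i))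
    (h₃ : mean I (fun i => (Iio q).indicator 1 (x i)) ≤ 1 - α + δ)
    (h₄ : 1 - α - δ ≤ mean I fun i => (Iic q).indicator 1 (x i)) :
    |plugIn α x I - (q + (1 / α) * e)| < r + K * δ / α := by
  have hu : 1 - α ∈ Ioo (0 : ℝ) 1 := ⟨by linarith, by linarith⟩
  have hKδ : 0 ≤ K * δ / α := by positivity
  obtain ⟨he1, he2⟩ := abs_lt.1 he
  have hup := plugIn_le hI x hα hα1 q
  have heq := plugIn_eq hI x hα hα1
  set p := VaR (empDistFun x I) (1 - α)
  set M := mean I fun i => max (x i - q) 0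
  -- `h₁` and `h₂` only serve to confine the empirical quantile `p` to `[q₁, q₂]`, within `K` of
  -- `q`.
  have hp1 : q₁ ≤ p := by
    by_contra! h
    have h5 := (VaR_empDistFun_le_iff hI x hu).1 (le_refl p)
    rw [empDistFun_eq_mean] at h5
    refine absurd (h5.trans (mean_mono fun i _ => ?_)) (not_le.2 h₁)
    exact indicator_le_indicator_of_subset (fun y hy => lt_of_le_of_lt hy h)
      (fun _ => zero_le_one) _
  have hp2 : p ≤ q₂ := (VaR_empDistFun_le_iff hI x hu).2 (by rwa [empDistFun_eq_mean])
  -- Moving the threshold from `q` to `p` changes the mean excess at a rate given by the frequency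
  -- above `q`, which is `α` up to `δ`. Only the lower frequency bound is needed if `p ≤ q`, only
  -- the upper one if `q ≤ p`.
  have key : M - (α * (p - q) + K * δ) ≤ mean I fun i => max (x i - p) 0 := by
    rcases le_total p q with h | h
    · have h6 : mean I (fun i => max (x i - q) 0 + (q - p) * (1 - (Iio q).indicator 1 (x i)))
          ≤ mean I fun i => max (x i - p) 0 := mean_mono fun i _ => by
        by_cases hx : x i < q
        · simp only [indicator, mem_Iio, hx, if_true, Pi.one_apply]
          rw [max_eq_right (by linarith : x i - q ≤ 0)]
          simp
        · simp only [indicator, mem_Iio, hx, if_false]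
          rw [max_eq_left (by linarith), max_eq_left (by linarith)]
          linarith
      rw [mean_add_mul_one_sub hI] at h6
      nlinarith [mul_le_mul_of_nonneg_left h₃ (sub_nonneg.2 h)]
    · have h6 : mean I (fun i => max (x i - q) 0 + (q - p) * (1 - (Iic q).indicator 1 (x i)))
          ≤ mean I fun i => max (x i - p) 0 := mean_mono fun i _ => by
        by_cases hx : x i ≤ q
        · simp only [indicator, mem_Iic, hx, if_true, Pi.one_apply]
          rw [max_eq_right (by linarith : x i - q ≤ 0)]
          simp
        · simp only [indicator, mem_Iic, hx, if_false]
          rw [max_eq_left (by linarith : 0 ≤ x i - q)]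
          exact le_max_of_le_left (by linarith)
      rw [mean_add_mul_one_sub hI] at h6
      nlinarith [mul_le_mul_of_nonneg_left h₄ (sub_nonneg.2 h)]
  have e1 : ∀ y : ℝ, (1 / α) * y = y / α := fun y => by ring
  rw [e1] at hup heq ⊢
  have h1 : M / α < e / α + r := by
    rw [div_add' _ _ _ hα.ne']
    exact div_lt_div_of_pos_right (by linarith) hα
  have h2 : e / α - r < M / α := by
    rw [div_sub' hα.ne']
    exact div_lt_div_of_pos_right (by linarith) hα
  have h3 := div_le_div_of_nonneg_right key hα.le
  have h4 : (M - (α * (p - q) + K * δ)) / α = M / α - (p - q) - K * δ / α := by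
    field_simp
    ring
  rw [abs_lt]
  constructor <;> linarith

end Empirical

/-! ### Chebyshev bounds for averages over sub-samples. -/

section Deviation

variable {Ω : Type*} [MeasurableSpace Ω] {μ : Measure Ω} {X : Ω → ℝ} {ι : Type*} {S : ι → Ω → ℝ}

/-- The event that the average of `f` over the sub-sample `I` deviates from its expectation by at
least `c`. -/
def deviationSet (μ : Measure Ω) (X : Ω → ℝ) (S : ι → Ω → ℝ) (I : Finset ι) (f : ℝ → ℝ) (c : ℝ) :
    Set Ω :=
  {ω | c ≤ |mean I (fun i => f (S i ω)) - ∫ ω', f (X ω') ∂μ|}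

/-- The σ-algebra is the one generated by the sub-sample, not the ambient one; this is what gives
independence across disjoint blocks. -/
lemma measurableSet_deviationSet (I : Finset ι) {f : ℝ → ℝ} (hf : Measurable f) (c : ℝ) :
    MeasurableSet[⨆ i ∈ (I : Set ι), MeasurableSpace.comap (S i) inferInstance]
      (deviationSet μ X S I f c) := by
  set m : MeasurableSpace Ω := ⨆ i ∈ (I : Set ι), MeasurableSpace.comap (S i) inferInstance with hm
  have h1 : ∀ i ∈ I, Measurable[m] fun ω => f (S i ω) := fun i hi =>
    hf.comp (((comap_measurable (S i)).mono
      (le_iSup₂_of_le (f := fun i (_ : i ∈ (I : Set ι)) =>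
        MeasurableSpace.comap (S i) inferInstance) i hi le_rfl) le_rfl))
  have h2 : Measurable[m] fun ω => mean I (fun i => f (S i ω)) :=
    (Finset.measurable_sum I h1).div_const _
  have h3 : Measurable[m] fun ω => |mean I (fun i => f (S i ω)) - ∫ ω', f (X ω') ∂μ| :=
    (h2.sub_const _).abs
  exact h3 measurableSet_Ici

lemma integral_indicator_comp (hX : Measurable X) {A : Set ℝ} (hA : MeasurableSet A) :
    ∫ ω, A.indicator (1 : ℝ → ℝ) (X ω) ∂μ = μ.real (X ⁻¹' A) := by
  have : (fun ω => A.indicator (1 : ℝ → ℝ) (X ω)) = (X ⁻¹' A).indicator 1 := rfl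
  rw [this, integral_indicator_one (hX hA)]

variable [IsProbabilityMeasure μ]

/-- Chebyshev's inequality for averages over sub-samples. -/
lemma measureReal_deviationSet_le (hS : iIndepFun S μ) (hid : ∀ i, IdentDistrib (S i) X μ μ)
    {I : Finset ι} (hI : I.Nonempty) {f : ℝ → ℝ} (hf : Measurable f)
    (hL2 : MemLp (fun ω => f (X ω)) 2 μ) {c : ℝ} (hc : 0 < c) :
    μ.real (deviationSet μ X S I f c) ≤ Var[fun ω => f (X ω); μ] / (I.card * c ^ 2) := by
  have hk : (0 : ℝ) < I.card := by exact_mod_cast hI.card_pos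
  have hidf : ∀ i, IdentDistrib (fun ω => f (S i ω)) (fun ω => f (X ω)) μ μ :=
    fun i => (hid i).comp hf
  have hL2i : ∀ i, MemLp (fun ω => f (S i ω)) 2 μ := fun i => (hidf i).memLp_iff.2 hL2
  have hsum : MemLp (fun ω => ∑ i ∈ I, f (S i ω)) 2 μ := memLp_finsetSum I fun i _ => hL2i i
  have hE : ∫ ω, ∑ i ∈ I, f (S i ω) ∂μ = I.card * ∫ ω, f (X ω) ∂μ := by
    rw [integral_finsetSum _ fun i _ => (hL2i i).integrable one_le_two]
    simp [fun i => (hidf i).integral_eq]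
  have hV : Var[fun ω => ∑ i ∈ I, f (S i ω); μ] = I.card * Var[fun ω => f (X ω); μ] := by
    have h := IndepFun.variance_sum (μ := μ) (X := fun i ω => f (S i ω)) (s := I)
      (fun i _ => hL2i i) fun i _ j _ hij => (hS.indepFun hij).comp hf hf
    simp only [fun i => (hidf i).variance_eq, Finset.sum_const, nsmul_eq_mul] at h
    rw [← h]
    congr 1
    ext ω
    simp
  have hcheb := meas_ge_le_variance_div_sq hsum (mul_pos hk hc)
  rw [hE, hV] at hcheb
  have hset : deviationSet μ X S I f c
      = {ω | I.card * c ≤ |∑ i ∈ I, f (S i ω) - I.card * ∫ ω', f (X ω') ∂μ|} := by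
    ext ω
    have : mean I (fun i => f (S i ω)) - ∫ ω', f (X ω') ∂μ
        = (∑ i ∈ I, f (S i ω) - I.card * ∫ ω', f (X ω') ∂μ) / I.card := by
      rw [mean]
      field_simp
    simp only [deviationSet, mem_ofPred_eq, this, abs_div, abs_of_pos hk]
    rw [le_div_iff₀ hk, mul_comm]
  rw [hset]
  refine (ENNReal.toReal_le_of_le_ofReal ?_ hcheb).trans_eq ?_
  · have := variance_nonneg (fun ω => f (X ω)) μ
    positivity
  · field_simp

/-- Deviation of an empirical frequency of a set whose complement has probability of order `α`. -/
lemma measureReal_deviationSet_indicator_le (hX : Measurable X) (hS : iIndepFun S μ)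
    (hid : ∀ i, IdentDistrib (S i) X μ μ) {I : Finset ι} (hI : I.Nonempty) {A : Set ℝ}
    (hA : MeasurableSet A) {α δ d : ℝ} (hα : 0 < α) (hδ : 0 < δ) (hδα : δ ≤ α / 2) (hd : δ ≤ d)
    (hp : 1 - μ.real (X ⁻¹' A) ≤ α + d) :
    μ.real (deviationSet μ X S I (A.indicator 1) d) ≤ 3 / 2 * α / (I.card * δ ^ 2) := by
  have hk : (0 : ℝ) < I.card := by exact_mod_cast hI.card_pos
  have hf : Measurable (A.indicator (1 : ℝ → ℝ)) := measurable_one.indicator hA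
  have hbd : ∀ ω, A.indicator (1 : ℝ → ℝ) (X ω) ∈ Icc (0 : ℝ) 1 := fun ω => by
    by_cases h : X ω ∈ A <;> simp [h]
  have hL2 : MemLp (fun ω => A.indicator (1 : ℝ → ℝ) (X ω)) 2 μ :=
    memLp_of_bounded (Eventually.of_forall hbd) (hf.comp hX).aestronglyMeasurable 2
  have hV : Var[fun ω => A.indicator (1 : ℝ → ℝ) (X ω); μ] ≤ α + d := by
    refine (variance_le_sub_mul_sub (Eventually.of_forall hbd) (hf.comp hX).aemeasurable).trans ?_
    rw [integral_indicator_comp hX hA]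
    have h1 : μ.real (X ⁻¹' A) ≤ 1 := measureReal_le_one
    nlinarith [measureReal_nonneg (μ := μ) (s := X ⁻¹' A)]
  have hd0 : 0 < d := hδ.trans_le hd
  refine (measureReal_deviationSet_le hS hid hI hf hL2 hd0).trans ?_
  rw [div_le_div_iff₀ (by positivity) (by positivity)]
  -- `d ↦ (α + d) / d²` is decreasing, so the worst case is `d = δ`, where `δ ≤ α / 2` gives the
  -- factor `3/2`.
  have h2 : (α + d) * δ ^ 2 ≤ 3 / 2 * α * d ^ 2 := by
    have h3 : (α + d) * δ ≤ (α + δ) * d := by nlinarith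
    calc (α + d) * δ ^ 2 = ((α + d) * δ) * δ := by ring
      _ ≤ ((α + δ) * d) * d := by gcongr
      _ = (α + δ) * d ^ 2 := by ring
      _ ≤ _ := by gcongr; linarith
  calc _ ≤ (α + d) * (I.card * δ ^ 2) := by gcongr
    _ = I.card * ((α + d) * δ ^ 2) := by ring
    _ ≤ I.card * (3 / 2 * α * d ^ 2) := by gcongr
    _ = _ := by ring

end Deviation

/-! ### Accuracy of the plug-in estimator on one block. -/

section Block

variable {Ω : Type*} [MeasurableSpace Ω] {μ : Measure Ω} [IsProbabilityMeasure μ] {X : Ω → ℝ}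

/-- On a block of length at least `11 / ε²`, the plug-in estimator is accurate outside of an event
of probability at most `5 / 22` that depends only on the sub-sample of the block. -/
lemma exists_bad_event {N : ℕ} {S : Fin N → Ω → ℝ} (hX : Measurable X) {α ε : ℝ} {L : NNReal}
    (hα : 0 < α) (hα2 : α < 1 / 2) (hσ : sigmaSq α (distFun μ X) ≠ ⊤)
    (hLip : LipschitzOnWith L (VaR (distFun μ X)) (Icc (1 - 2 * α) (1 - α / 2)))
    (hpos : 0 < sigma α (distFun μ X) ∨ 0 < L) (hε : 0 < ε) (hεα : ε < 1 / 4 * √α)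
    (hS : iIndepFun S μ) (hid : ∀ i, IdentDistrib (S i) X μ μ) {I : Finset (Fin N)}
    (hI : 11 / ε ^ 2 ≤ I.card) :
    ∃ B : Set Ω,
      MeasurableSet[⨆ i ∈ (I : Set (Fin N)), MeasurableSpace.comap (S i) inferInstance] B ∧
      μ.real B ≤ 5 / 22 ∧ ∀ ω ∉ B, |plugIn α (fun i => S i ω) I - ES α (distFun μ X)|
        < ε * sigma α (distFun μ X) + 5 * L * ε ^ 2 := by
  have hI' : 11 ≤ I.card * ε ^ 2 := by rwa [div_le_iff₀ (by positivity)] at hI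
  have hk : (0 : ℝ) < I.card := lt_of_lt_of_le (by positivity) hI
  have hne : I.Nonempty := Finset.card_pos.1 (by exact_mod_cast hk)
  set σ := sigma α (distFun μ X) with hσdef
  have hσ0 : 0 ≤ σ := sigma_nonneg _ _
  have hL0 : (0 : ℝ) ≤ L := L.2
  -- The extra `L * ε ^ 2` keeps the Chebyshev threshold positive when `σ = 0`.
  set r := ε * σ + L * ε ^ 2 with hr
  have hr0 : 0 < r := by
    rcases hpos with h | h
    · positivity
    · have : (0 : ℝ) < L := h
      positivity
  have hsα : 0 < √α := Real.sqrt_pos.2 hα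
  have hsα2 : √α * √α = α := Real.mul_self_sqrt hα.le
  -- A frequency of variance of order `α` over `11 / ε²` points fluctuates on the scale `ε√α`. The
  -- bound on `ε` gives `δ ≤ α / 2`, which keeps the levels `1 - α ± δ` inside the Lipschitz
  -- interval.
  set δ := 2 * ε * √α with hδdef
  have hδ : 0 < δ := by positivity
  have hδα : δ ≤ α / 2 := by nlinarith
  have hδ2 : δ ^ 2 = 4 * ε ^ 2 * α := by rw [hδdef, mul_pow, Real.sq_sqrt hα.le]; ring
  set q := VaR (distFun μ X) (1 - α) with hq
  set q₁ := VaR (distFun μ X) (1 - α - δ) with hq₁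
  set q₂ := VaR (distFun μ X) (1 - α + δ) with hq₂
  have hα0 : 1 - α ∈ Ioo (0 : ℝ) 1 := ⟨by linarith, by linarith⟩
  have hα1 : 1 - α - δ ∈ Ioo (0 : ℝ) 1 := ⟨by linarith, by linarith⟩
  have hα2' : 1 - α + δ ∈ Ioo (0 : ℝ) 1 := ⟨by linarith, by linarith⟩
  have hq₁K : q - q₁ ≤ L * δ := by
    have h := hLip.dist_le_mul (1 - α) ⟨by linarith, by linarith⟩ (1 - α - δ)
      ⟨by linarith, by linarith⟩
    rw [Real.dist_eq, Real.dist_eq, sub_sub_cancel, abs_of_pos hδ] at h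
    exact (le_abs_self _).trans h
  have hq₂K : q₂ - q ≤ L * δ := by
    have h := hLip.dist_le_mul (1 - α + δ) ⟨by linarith, by linarith⟩ (1 - α)
      ⟨by linarith, by linarith⟩
    rw [Real.dist_eq, Real.dist_eq, add_sub_cancel_left, abs_of_pos hδ] at h
    exact (le_abs_self _).trans h
  set p₁ := μ.real (X ⁻¹' Iio q₁)
  set p₂ := μ.real (X ⁻¹' Iic q₂)
  set p₃ := μ.real (X ⁻¹' Iio q)
  set p₄ := μ.real (X ⁻¹' Iic q)
  have hp₁ : p₁ ≤ 1 - α - δ := measureReal_lt_VaR_le hX hα1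
  have hp₂ : 1 - α + δ ≤ p₂ := le_distFun_VaR hX hα2'
  have hp₃ : p₃ ≤ 1 - α := measureReal_lt_VaR_le hX hα0
  have hp₄ : 1 - α ≤ p₄ := le_distFun_VaR hX hα0
  have hZ : Measurable fun x : ℝ => max (x - q) 0 := by fun_prop
  have hind : ∀ A : Set ℝ, MeasurableSet A → Measurable (A.indicator (1 : ℝ → ℝ)) :=
    fun A hA => measurable_one.indicator hA
  have hfreq : ∀ {A : Set ℝ} {d : ℝ}, MeasurableSet A → δ ≤ d → 1 - μ.real (X ⁻¹' A) ≤ α + d →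
      μ.real (deviationSet μ X S I (A.indicator 1) d) ≤ 3 / 88 := by
    intro A d hA hd hp
    refine (measureReal_deviationSet_indicator_le hX hS hid hne hA hα hδ hδα hd hp).trans ?_
    rw [div_le_iff₀ (by positivity), hδ2]
    nlinarith
  set B₀ := deviationSet μ X S I (fun x => max (x - q) 0) (α * r)
  -- Each of the four thresholds is the gap between the true probability and the bound required of
  -- the empirical one: at least `δ`, possibly more if `X` has atoms.
  set B₁ := deviationSet μ X S I ((Iio q₁).indicator 1) (1 - α - p₁)
  set B₂ := deviationSet μ X S I ((Iic q₂).indicator 1) (p₂ - (1 - α))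
  set B₃ := deviationSet μ X S I ((Iio q).indicator 1) (1 - α + δ - p₃)
  set B₄ := deviationSet μ X S I ((Iic q).indicator 1) (p₄ - (1 - α - δ))
  have hB₀ : μ.real B₀ ≤ 1 / 11 := by
    refine (measureReal_deviationSet_le hS hid hne hZ (memLp_posPart hX hα hα2 hσ)
      (by positivity)).trans ?_
    rw [variance_posPart hX hα hα2 hσ, div_le_iff₀ (by positivity), ← hσdef]
    have h1 : (ε * σ) ^ 2 ≤ r ^ 2 := by
      gcongr
      exact le_add_of_nonneg_right (by positivity)
    have h2 : 11 * σ ^ 2 ≤ I.card * r ^ 2 := by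
      calc 11 * σ ^ 2 ≤ (I.card * ε ^ 2) * σ ^ 2 := by gcongr
        _ = I.card * (ε * σ) ^ 2 := by ring
        _ ≤ _ := by gcongr
    nlinarith [mul_le_mul_of_nonneg_left h2 (sq_nonneg α)]
  have hB₁ : μ.real B₁ ≤ 3 / 88 := hfreq measurableSet_Iio (by linarith) (by linarith)
  have hB₂ : μ.real B₂ ≤ 3 / 88 := hfreq measurableSet_Iic (by linarith) (by linarith)
  have hB₃ : μ.real B₃ ≤ 3 / 88 := hfreq measurableSet_Iio (by linarith) (by linarith)
  have hB₄ : μ.real B₄ ≤ 3 / 88 := hfreq measurableSet_Iic (by linarith) (by linarith)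
  refine ⟨B₀ ∪ B₁ ∪ B₂ ∪ B₃ ∪ B₄, ?_, ?_, ?_⟩
  · exact ((((measurableSet_deviationSet I hZ _).union
      (measurableSet_deviationSet I (hind _ measurableSet_Iio) _)).union
      (measurableSet_deviationSet I (hind _ measurableSet_Iic) _)).union
      (measurableSet_deviationSet I (hind _ measurableSet_Iio) _)).union
      (measurableSet_deviationSet I (hind _ measurableSet_Iic) _)
  -- `1/11 + 4 * (3/88) = 5/22`.
  · linarith [measureReal_union_le (μ := μ) (B₀ ∪ B₁ ∪ B₂ ∪ B₃) B₄,
      measureReal_union_le (μ := μ) (B₀ ∪ B₁ ∪ B₂) B₃, measureReal_union_le (μ := μ) (B₀ ∪ B₁) B₂,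
      measureReal_union_le (μ := μ) B₀ B₁]
  · intro ω hω
    simp only [mem_union, not_or] at hω
    obtain ⟨⟨⟨⟨h0, h1⟩, h2⟩, h3⟩, h4⟩ := hω
    simp only [B₀, B₁, B₂, B₃, B₄, deviationSet, mem_ofPred_eq, not_le] at h0 h1 h2 h3 h4
    rw [integral_indicator_comp hX measurableSet_Iio] at h1 h3
    rw [integral_indicator_comp hX measurableSet_Iic] at h2 h4
    rw [abs_lt] at h1 h2 h3 h4
    have hfin := abs_plugIn_sub_lt hne (fun i => S i ω) hα (by linarith) hδ.le
      (by positivity : 0 ≤ L * δ) hq₁K hq₂K h0 (by linarith) (by linarith) (by linarith)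
      (by linarith)
    rw [ES_eq hX hα (by linarith)
      ((memLp_posPart hX hα hα2 hσ).integrable one_le_two)]
    refine hfin.trans_eq ?_
    have : L * δ * δ / α = 4 * L * ε ^ 2 := by
      rw [mul_assoc, ← sq, hδ2]
      field_simp
    rw [this, hr]
    ring

end Block

/-! ### Independence of block events and Hoeffding's inequality. -/

section Independence

variable {Ω : Type*} {mΩ : MeasurableSpace Ω} {μ : Measure Ω}

/-- Events that depend on disjoint groups of independent σ-algebras are independent. -/
lemma iIndepSet_of_pairwise_disjoint {ι κ : Type*} {m : ι → MeasurableSpace Ω}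
    (hm : ∀ i, m i ≤ mΩ) (h : iIndep m μ) {J : κ → Set ι} (hJ : Pairwise (Function.onFun Disjoint J))
    {B : κ → Set Ω} (hB : ∀ k, MeasurableSet[⨆ i ∈ J k, m i] (B k)) : iIndepSet B μ := by
  classical
  have := h.isProbabilityMeasure
  rw [iIndepSet_iff_meas_biInter fun k => iSup₂_le (fun i _ => hm i) _ (hB k)]
  intro s
  induction s using Finset.induction with
  | empty => simp
  | insert a s ha ih =>
    rw [Finset.set_biInter_insert, Finset.prod_insert ha, ← ih]
    have hd : Disjoint (J a) (⋃ k ∈ s, J k) := by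
      rw [disjoint_iUnion₂_right]
      exact fun k hk => hJ fun hak => ha (hak ▸ hk)
    refine (Indep_iff _ _ _).1 (indep_iSup_of_disjoint hm h hd) _ _ (hB a) ?_
    refine Finset.measurableSet_biInter s fun k hk => ?_
    refine (iSup₂_le fun i hi => ?_ : ⨆ i ∈ J k, m i ≤ ⨆ i ∈ ⋃ k ∈ s, J k, m i) _ (hB k)
    exact le_iSup₂_of_le (f := fun i (_ : i ∈ ⋃ k ∈ s, J k) => m i) i
      (mem_iUnion₂.2 ⟨k, hk, hi⟩) le_rfl

open scoped Classical in
/-- Hoeffding's inequality for the number of occurring events. -/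
lemma measureReal_card_ge_le {n : ℕ} (hn : 0 < n) {B : Fin n → Set Ω} (hB : iIndepSet B μ)
    (hmB : ∀ j, MeasurableSet (B j)) {p t : ℝ} (ht : 0 ≤ t) (hp : ∀ j, μ.real (B j) ≤ p) :
    μ.real {ω | (p + t) * n ≤ (Finset.univ.filter fun j => ω ∈ B j).card}
      ≤ Real.exp (-(2 * t ^ 2 * n)) := by
  have := hB.isProbabilityMeasure
  have hn' : (0 : ℝ) < n := by exact_mod_cast hn
  have hm : ∀ j, Measurable ((B j).indicator (1 : Ω → ℝ)) :=
    fun j => measurable_one.indicator (hmB j)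
  have hE : ∀ j, μ[(B j).indicator (1 : Ω → ℝ)] = μ.real (B j) :=
    fun j => integral_indicator_one (hmB j)
  have hsub : ∀ j ∈ (Finset.univ : Finset (Fin n)),
      HasSubgaussianMGF (fun ω => (B j).indicator (1 : Ω → ℝ) ω - μ.real (B j))
        ((‖(1 : ℝ) - 0‖₊ / 2) ^ 2) μ := fun j _ => by
    rw [← hE j]
    refine hasSubgaussianMGF_of_mem_Icc (hm j).aemeasurable (Eventually.of_forall fun ω => ?_)
    by_cases h : ω ∈ B j <;> simp [h]
  have hind : iIndepFun (fun j ω => (B j).indicator (1 : Ω → ℝ) ω - μ.real (B j)) μ :=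
    (hB.iIndepFun_indicator (β := ℝ)).comp (fun j x => x - μ.real (B j))
      fun j => measurable_id.sub_const _
  have hH := HasSubgaussianMGF.measure_sum_ge_le_of_iIndepFun hind hsub
    (mul_nonneg ht hn'.le)
  refine (measureReal_mono ?_).trans (hH.trans_eq ?_)
  · intro ω hω
    simp only [mem_ofPred_eq] at hω ⊢
    have h1 : ((Finset.univ.filter fun j => ω ∈ B j).card : ℝ)
        = ∑ j, (B j).indicator (1 : Ω → ℝ) ω := by
      rw [Finset.card_filter]
      simp [indicator]
    have h2 : ∑ j, μ.real (B j) ≤ n * p :=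
      (Finset.sum_le_sum fun j _ => hp j).trans_eq (by simp)
    rw [Finset.sum_sub_distrib, ← h1]
    linarith
  -- The variance proxies `1/4` sum to `n/4`, and `(t n)² / (2 * (n/4)) = 2 t² n`.
  · congr 1
    simp
    field_simp

end Independence

/-! ### Robustness of central empirical quantiles. -/

section OrderStatistics

/-- Pigeonhole: an order statistic `≤ a` would put the `k + 1` smallest values in `T`, and one `≥ b`
would put the `n - k` largest there; both exceed the size of `T`. -/
lemma orderStat_mem_Ioo {n : ℕ} {y : Fin n → ℝ} {a b : ℝ} {T : Finset (Fin n)}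
    (hT : ∀ j ∉ T, y j ∈ Ioo a b) {k : ℕ} (hk : T.card ≤ k) (hkn : k + T.card < n) :
    orderStat y k ∈ Ioo a b := by
  have hlt : k < n := by omega
  rw [orderStat, dif_pos hlt]
  have hmono := Tuple.monotone_sort y
  constructor
  · by_contra! h
    have hsub : (Finset.Iic (⟨k, hlt⟩ : Fin n)).map (Tuple.sort y).toEmbedding ⊆ T := by
      intro j hj
      obtain ⟨l, hl, rfl⟩ := Finset.mem_map.1 hj
      by_contra hjT
      exact absurd (hT _ hjT).1 (not_lt.2 ((hmono (Finset.mem_Iic.1 hl)).trans h))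
    have := Finset.card_le_card hsub
    rw [Finset.card_map, Fin.card_Iic] at this
    simp only at this
    omega
  · by_contra! h
    have hsub : (Finset.Ici (⟨k, hlt⟩ : Fin n)).map (Tuple.sort y).toEmbedding ⊆ T := by
      intro j hj
      obtain ⟨l, hl, rfl⟩ := Finset.mem_map.1 hj
      by_contra hjT
      exact absurd (hT _ hjT).2 (not_lt.2 (h.trans (hmono (Finset.mem_Ici.1 hl))))
    have := Finset.card_le_card hsub
    rw [Finset.card_map, Fin.card_Ici] at this
    simp only at this
    omega

/-- Central empirical quantiles are robust against a minority of outliers. -/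
lemma empQuantile_mem_Ioo {n : ℕ} (hn : 100 ≤ n) {y : Fin n → ℝ} {a b : ℝ} {T : Finset (Fin n)}
    (hT : ∀ j ∉ T, y j ∈ Ioo a b) (hcard : (T.card : ℝ) ≤ 0.33 * n) {β : ℝ} (hβ₁ : 0.35 ≤ β)
    (hβ₂ : β ≤ 0.65) : empQuantile y β ∈ Ioo a b := by
  have hn' : (100 : ℝ) ≤ n := by exact_mod_cast hn
  rw [empQuantile]
  set h : ℝ := ((n : ℝ) - 1) * β
  have h1 : 0.35 * ((n : ℝ) - 1) ≤ h := by simp only [h]; nlinarith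
  have h2 : h ≤ 0.65 * ((n : ℝ) - 1) := by simp only [h]; nlinarith
  have h3 : (⌊h⌋₊ : ℝ) ≤ h := Nat.floor_le (by linarith)
  have h4 : h < ⌊h⌋₊ + 1 := Nat.lt_floor_add_one h
  -- Both interpolation nodes `⌊h⌋₊` and `⌊h⌋₊ + 1` must be central. The margin between `0.33 n` and
  -- `0.35 (n - 1)` absorbs the rounding since `n ≥ 100`.
  have hk : T.card ≤ ⌊h⌋₊ := by
    have : (T.card : ℝ) ≤ ⌊h⌋₊ := by linarith
    exact_mod_cast this
  have hkn : ⌊h⌋₊ + 1 + T.card < n := by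
    have : (⌊h⌋₊ : ℝ) + 1 + T.card < n := by linarith
    exact_mod_cast this
  have hm := convex_Ioo a b (orderStat_mem_Ioo hT hk (by omega))
    (orderStat_mem_Ioo hT (hk.trans (Nat.le_succ _)) hkn)
    (by linarith : 0 ≤ 1 - (h - ⌊h⌋₊)) (by linarith : 0 ≤ h - ⌊h⌋₊) (by ring)
  convert hm using 1
  simp only [smul_eq_mul]
  ring

end OrderStatistics

/-! ### Combinatorics of the blocks. -/

section Blocks

variable {ε : ℝ} {N : ℕ}

lemma card_block (j : Fin (numBlocks ε N)) : (block ε N j).card = blockLength ε := by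
  have hle : (j.val + 1) * blockLength ε ≤ N :=
    (Nat.mul_le_mul_right _ j.isLt).trans (Nat.div_mul_le_self N (blockLength ε))
  have h : (block ε N j).map Fin.valEmbedding
      = Finset.Ico (j.val * blockLength ε) ((j.val + 1) * blockLength ε) := by
    ext i
    simp only [block, Finset.mem_map, Finset.mem_filter, Finset.mem_univ, true_and,
      Fin.valEmbedding_apply, Finset.mem_Ico]
    exact ⟨fun ⟨l, hl, hli⟩ => hli ▸ hl, fun hi => ⟨⟨i, hi.2.trans_le hle⟩, hi, rfl⟩⟩
  rw [← Finset.card_map Fin.valEmbedding, h, Nat.card_Ico, ← Nat.sub_mul]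
  simp

lemma eq_of_mem_block {j j' : Fin (numBlocks ε N)} {i : Fin N} (h : i ∈ block ε N j)
    (h' : i ∈ block ε N j') : j = j' := by
  simp only [block, Finset.mem_filter, Finset.mem_univ, true_and] at h h'
  have h1 := lt_of_mul_lt_mul_right (h.1.trans_lt h'.2) (Nat.zero_le _)
  have h2 := lt_of_mul_lt_mul_right (h'.1.trans_lt h.2) (Nat.zero_le _)
  ext
  omega

lemma pairwise_disjoint_block :
    Pairwise (Function.onFun Disjoint fun j => (block ε N j : Set (Fin N))) := fun _ _ hj =>
  Set.disjoint_left.2 fun _ hi hi' => hj (eq_of_mem_block hi hi')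

lemma plugIn_congr {α : ℝ} {x y : Fin N → ℝ} {I : Finset (Fin N)} (h : ∀ i ∈ I, x i = y i) :
    plugIn α x I = plugIn α y I := by
  have : empDistFun x I = empDistFun y I := by
    ext t
    rw [empDistFun, empDistFun, Finset.filter_congr fun i hi => by rw [h i hi]]
  rw [plugIn, plugIn, this]

-- Choosing a modified index in each affected block is injective because the blocks are disjoint.
open scoped Classical in
lemma card_modified_blocks_le (x y : Fin N → ℝ) :
    (Finset.univ.filter fun j => ∃ i ∈ block ε N j, x i ≠ y i).card
      ≤ (Finset.univ.filter fun i => x i ≠ y i).card := by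
  have hc : ∀ j : Fin (numBlocks ε N), ∃ i : Fin N,
      (∃ i ∈ block ε N j, x i ≠ y i) → i ∈ block ε N j ∧ x i ≠ y i := fun j => by
    by_cases h : ∃ i ∈ block ε N j, x i ≠ y i
    · exact h.imp fun i hi _ => hi
    -- Unaffected blocks need an arbitrary value of the choice function; the existence of a block
    -- forces `N > 0`.
    · have hN : 0 < N := by
        by_contra! h0
        have := j.isLt
        simp [numBlocks, Nat.le_zero.1 h0] at this
      exact ⟨⟨0, hN⟩, fun h' => absurd h' h⟩
  choose f hf using hc
  refine Finset.card_le_card_of_injOn f (fun j hj => ?_) fun j hj j' hj' hjj' => ?_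
  · simpa using (hf j (by simpa using hj)).2
  · have h1 := (hf j (by simpa using hj)).1
    have h2 := (hf j' (by simpa using hj')).1
    exact eq_of_mem_block h1 (hjj' ▸ h2)

lemma le_blockLength : 11 / ε ^ 2 ≤ blockLength ε := Nat.le_ceil _

lemma blockLength_mul_sq_le (hε : 0 < ε) (hε1 : ε ≤ 1) : blockLength ε * ε ^ 2 ≤ 12 := by
  have h1 : (blockLength ε : ℝ) < 11 / ε ^ 2 + 1 := Nat.ceil_lt_add_one (by positivity)
  have h2 : (blockLength ε : ℝ) * ε ^ 2 ≤ (11 / ε ^ 2 + 1) * ε ^ 2 := by gcongr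
  have h3 : (11 / ε ^ 2 + 1) * ε ^ 2 = 11 + ε ^ 2 := by field_simp
  nlinarith

/-- `N` is less than `n + 1` block lengths, and each block length is at most `12 / ε²`, rounding
included. -/
lemma mul_sq_le_numBlocks (hε : 0 < ε) (hε1 : ε ≤ 1) : N * ε ^ 2 ≤ 12 * (numBlocks ε N + 1) := by
  have hm : 0 < blockLength ε := Nat.ceil_pos.2 (by positivity)
  have h1 : (N : ℝ) ≤ blockLength ε * (numBlocks ε N + 1) := by
    exact_mod_cast (Nat.lt_mul_div_succ N hm).le
  calc N * ε ^ 2 ≤ blockLength ε * (numBlocks ε N + 1) * ε ^ 2 := by gcongr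
    _ = (blockLength ε * ε ^ 2) * (numBlocks ε N + 1) := by ring
    _ ≤ _ := by gcongr; exact blockLength_mul_sq_le hε hε1

end Blocks

/-! ### The truncated estimator on corrupted data. -/

section Estimator

open scoped Classical in
/-- The estimator is accurate as soon as the plug-in estimator is accurate, on the unmodified
sample, for most blocks, and few of the data are modified. -/
lemma abs_estimator_sub_lt {α ε β₁ β₂ : ℝ} {N : ℕ} {x y : Fin N → ℝ} {e r : ℝ}
    (hn : 100 ≤ numBlocks ε N) (hβ₁ : 0.35 ≤ β₁) (hβ : β₁ ≤ β₂) (hβ₂ : β₂ ≤ 0.65)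
    {T : Finset (Fin (numBlocks ε N))} (hT : ∀ j ∉ T, |plugIn α x (block ε N j) - e| < r)
    (hcard : (T.card : ℝ) ≤ 0.28 * numBlocks ε N)
    (hmod : ((Finset.univ.filter fun i => y i ≠ x i).card : ℝ) ≤ 0.05 * numBlocks ε N) :
    |estimator α ε β₁ β₂ y - e| < r := by
  set T' := T ∪ Finset.univ.filter fun j => ∃ i ∈ block ε N j, y i ≠ x i
  have hT' : ∀ j ∉ T', plugIn α y (block ε N j) ∈ Ioo (e - r) (e + r) := by
    intro j hj
    simp only [T', Finset.mem_union, Finset.mem_filter, Finset.mem_univ, true_and, not_or,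
      not_exists, not_and, not_not] at hj
    rw [plugIn_congr hj.2]
    have := abs_lt.1 (hT j hj.1)
    exact ⟨by linarith, by linarith⟩
  have hcard' : (T'.card : ℝ) ≤ 0.33 * numBlocks ε N := by
    have h1 : (T'.card : ℝ) ≤ T.card + (Finset.univ.filter fun i => y i ≠ x i).card := by
      exact_mod_cast (Finset.card_union_le _ _).trans
        (Nat.add_le_add_left (card_modified_blocks_le y x) _)
    linarith
  have h1 := empQuantile_mem_Ioo hn hT' hcard' hβ₁ (hβ.trans hβ₂)
  have h2 := empQuantile_mem_Ioo hn hT' hcard' (hβ₁.trans hβ) hβ₂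
  -- The two quantiles alone bound the estimator, so no control of the corrupted full-sample plug-in
  -- is needed.
  rw [estimator, abs_lt]
  constructor
  · exact lt_sub_iff_add_lt.2 (lt_min (lt_max_of_lt_right (by linarith [h1.1])) (by linarith [h2.1]))
  · exact sub_lt_iff_lt_add'.2 ((min_le_right _ _).trans_lt h2.2)

variable {Ω : Type*} [MeasurableSpace Ω] {μ : Measure Ω} [IsProbabilityMeasure μ] {X : Ω → ℝ}

lemma measureReal_estimator_le {N : ℕ} {S Y : Fin N → Ω → ℝ} (hX : Measurable X)
    {α β₁ β₂ ε : ℝ} {L : NNReal}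
    (hα : 0 < α) (hα2 : α < 1 / 2) (hσ : sigmaSq α (distFun μ X) ≠ ⊤)
    (hLip : LipschitzOnWith L (VaR (distFun μ X)) (Icc (1 - 2 * α) (1 - α / 2)))
    (hpos : 0 < sigma α (distFun μ X) ∨ 0 < L) (hβ₁ : 0.35 ≤ β₁) (hβ : β₁ ≤ β₂) (hβ₂ : β₂ ≤ 0.65)
    (hε : 0 < ε) (hεα : ε < 1 / 4 * √α) (hN : 1300 / ε ^ 2 ≤ N) (hSm : ∀ i, Measurable (S i))
    (hS : iIndepFun S μ) (hid : ∀ i, IdentDistrib (S i) X μ μ)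
    (hY : ∀ᵐ ω ∂μ, ((Finset.univ.filter fun i : Fin N => Y i ω ≠ S i ω).card : ℝ)
      ≤ 1 / 260 * N * ε ^ 2) :
    μ.real {ω | ε * sigma α (distFun μ X) + 5 * L * ε ^ 2
        ≤ |estimator α ε β₁ β₂ (fun i => Y i ω) - ES α (distFun μ X)|}
      ≤ Real.exp (-(1 / 2600 * N * ε ^ 2)) := by
  classical
  have hε1 : ε ≤ 1 := by
    have : √α ≤ 1 := Real.sqrt_le_one.2 (by linarith)
    linarith
  rw [div_le_iff₀ (by positivity)] at hN
  have hnN := mul_sq_le_numBlocks (N := N) hε hε1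
  have hn : 100 ≤ numBlocks ε N := by
    have : (100 : ℝ) ≤ numBlocks ε N := by linarith
    exact_mod_cast this
  choose B hBm hBp hBω using fun j : Fin (numBlocks ε N) =>
    exists_bad_event (I := block ε N j) hX hα hα2 hσ hLip hpos hε hεα hS hid
      (by rw [card_block]; exact le_blockLength)
  have hle : ∀ i, MeasurableSpace.comap (S i) inferInstance ≤ ‹MeasurableSpace Ω› :=
    fun i => (hSm i).comap_le
  have hBind : iIndepSet B μ :=
    iIndepSet_of_pairwise_disjoint hle hS.iIndep pairwise_disjoint_block hBm
  -- The slack `0.05` is chosen so that `5/22 + 0.05 < 0.28`.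
  have hHoeff := measureReal_card_ge_le (t := 0.05) (by omega) hBind
    (fun j => iSup₂_le (fun i _ => hle i) _ (hBm j)) (by norm_num) hBp
  -- Monotonicity up to null sets needs no measurability, so the `Y i` may be arbitrary functions.
  refine (ENNReal.toReal_mono (measure_ne_top _ _) (measure_mono_ae ?_)).trans
    (hHoeff.trans (Real.exp_le_exp.2 ?_))
  · filter_upwards [hY] with ω hω hbad
    by_contra hfew
    have hfew' : ¬ (5 / 22 + 0.05) * (numBlocks ε N : ℝ)
      ≤ (Finset.univ.filter fun j => ω ∈ B j).card := hfew
    refine absurd hbad (not_le.2 (abs_estimator_sub_lt (x := fun i => S i ω)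
      (T := Finset.univ.filter fun j => ω ∈ B j) hn hβ₁ hβ hβ₂
      (fun j hj => hBω j ω (by simpa using hj)) ?_ ?_))
    · have : (0 : ℝ) ≤ numBlocks ε N := Nat.cast_nonneg _
      linarith
    -- Here `N ε² / 260 ≤ 12 (n + 1) / 260 ≤ 0.05 n`, as `n ≥ 100`; the exponent below is the same
    -- inequality divided by 10, as `2 * 0.05² = 0.005`.
    · refine le_trans (le_of_eq_of_le ?_ hω) (by linarith)
      congr
  · linarith

end Estimator

end ExpectedShortfall

end

theorem mainTheorem2 :
    ∃ c₀ c₁ C₀ C₁ C₂ : ℝ, 0 < c₀ ∧ 0 < c₁ ∧ 0 < C₀ ∧ 0 < C₁ ∧ 0 < C₂ ∧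
      ∀ (Ω : Type*) [MeasurableSpace Ω] (μ : Measure Ω) [IsProbabilityMeasure μ]
        (X : Ω → ℝ) (α : ℝ) (L : NNReal) (β₁ β₂ ε : ℝ) (N : ℕ)
        -- the original sample and the modified sample
        (S : Fin N → Ω → ℝ) (Y : Fin N → Ω → ℝ),
        Measurable X →
        0 < α → α < 1 / 2 →
        ExpectedShortfall.sigmaSq α (ExpectedShortfall.distFun μ X) ≠ ⊤ →
        LipschitzOnWith L (ExpectedShortfall.VaR (ExpectedShortfall.distFun μ X))
          (Set.Icc (1 - 2 * α) (1 - α / 2)) →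
        -- the error radius below is not zero
        (0 < ExpectedShortfall.sigma α (ExpectedShortfall.distFun μ X) ∨ 0 < L) →
        0.35 ≤ β₁ → β₁ ≤ β₂ → β₂ ≤ 0.65 →
        0 < ε → ε < c₀ * Real.sqrt α →
        c₁ / ε ^ 2 ≤ (N : ℝ) →
        iIndepFun S μ →
        (∀ i, IdentDistrib (S i) X μ μ) →
        -- almost surely, at most `C₀ N ε²` of the samples are modified
        (∀ᵐ ω ∂μ,
          ((Finset.univ.filter fun i : Fin N => Y i ω ≠ S i ω).card : ℝ) ≤ C₀ * N * ε ^ 2) →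
        μ.real {ω | ε * ExpectedShortfall.sigma α (ExpectedShortfall.distFun μ X)
              + C₁ * L * ε ^ 2
            ≤ |ExpectedShortfall.estimator α ε β₁ β₂ (fun i => Y i ω)
                - ExpectedShortfall.ES α (ExpectedShortfall.distFun μ X)|}
          ≤ Real.exp (-(C₂ * N * ε ^ 2)) := by
  refine ⟨1 / 4, 1300, 1 / 260, 5, 1 / 2600, by norm_num, by norm_num, by norm_num, by norm_num,
    by norm_num, ?_⟩
  intro Ω _ μ _ X α L β₁ β₂ ε N S Y hX hα hα2 hσ hLip hpos hβ₁ hβ hβ₂ hε hεα hN hS hid hY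
  -- Identical distribution only gives a.e. measurability. Measurable versions make the generated
  -- σ-algebras lie in the ambient one, and almost surely leave the count of modifications
  -- unchanged.
  have hae : ∀ i, S i =ᵐ[μ] (hid i).aemeasurable_fst.mk (S i) :=
    fun i => (hid i).aemeasurable_fst.ae_eq_mk
  refine ExpectedShortfall.measureReal_estimator_le
    (S := fun i => (hid i).aemeasurable_fst.mk (S i)) hX hα hα2 hσ hLip hpos hβ₁ hβ hβ₂ hε hεα hN
    (fun i => (hid i).aemeasurable_fst.measurable_mk) (hS.congr hae)
    (fun i => (IdentDistrib.of_ae_eq (hid i).aemeasurable_fst (hae i)).symm.trans (hid i)) ?_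
  filter_upwards [hY, Filter.eventually_all.2 hae] with ω h1 h2
  simpa only [h2] using h1
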